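/- Let $X_1,X_2,\ldots$ be i.i.d. real random variables with a bounded density $f$, and let $x_0\in\mathbb{R}$ be a point at which $f$ is positive and four times continuously differentiable (that is, $f$ is $C^4$ in a neighbourhood of $x_0$). Let $K:\mathbb{R}\to[0,\infty)$ be a symmetric bounded kernel with $\int K(u)\,du=1$, $\mu_2=\int u^2K(u)\,du<\infty$, $\int K(u)^2\,du<\infty$ and $\int u^4K(u)\,du<\infty$. For a bandwidth $h>0$ let $\hat f_h(x_0)=(nh)^{-1}\sum_{i=1}^nK\big((X_i-x_0)/h\big)$, let $\sigma_h\ge 0$ be given by $\sigma_h^2=nh\,\mathrm{Var}\big(\hat f_h(x_0)\big)$, and let $\Phi$ be the standard normal distribution function. Suppose that $h=h_n>0$ satisfies $nh\to\infty$ and $h=O(n^{-1/5})$ as $n\to\infty$. Then, for any fixed $y\in\mathbb{R}$, as $n\to\infty$, $$\mathbb{P}\Big((nh)^{1/2}\big\{\hat f_h(x_0)-f(x_0)\big\}\le y\Big)=\Phi\left(\frac{y-n^{1/2}h^{5/2}f''(x_0)\mu_2/2}{\sigma_h}\right)+O\big\{n^{1/2}h^{9/2}+(nh)^{-1/2}\big\}.$$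 -/

import Mathlib

open MeasureTheory ProbabilityTheory Filter Asymptotics
open scoped Topology

noncomputable section

/-- A univariate, non-negative, symmetric and bounded kernel function that integrates to one,
with finite second moment and finite integral of its square. -/
structure IsDensityKernel (K : ℝ → ℝ) : Prop where
  measurable : Measurable K
  nonneg : ∀ u, 0 ≤ K u
  symmetric : ∀ u, K (-u) = K u
  bounded : ∃ M : ℝ, ∀ u, K u ≤ M
  integrable : Integrable K
  integral_eq_one : ∫ u, K u = 1
  integrable_sq_mul : Integrable fun u => u ^ 2 * K u
  integrable_sq : Integrable fun u => K u ^ 2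

/-- The second moment `μ₂ = ∫ u² K(u) du` of a kernel. -/
def kernelMoment2 (K : ℝ → ℝ) : ℝ := ∫ u, u ^ 2 * K u

/-- The kernel density estimator `(n h)⁻¹ ∑ K((Xᵢ - x₀) / h)` of the density at `x₀`, from the
first `n` observations of the sequence `X`, with bandwidth `h`. -/
def kernelDensityEstimator {Ω : Type*} (K : ℝ → ℝ) (X : ℕ → Ω → ℝ) (n : ℕ) (h x₀ : ℝ) (ω : Ω) : ℝ :=
  ((n : ℝ) * h)⁻¹ * ∑ i ∈ Finset.range n, K ((X i ω - x₀) / h)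

/-- `σ_h`, the non-negative square root of `σ_h² = n h Var(f̂_h(x₀))`. -/
def kdeSigma {Ω : Type*} [MeasurableSpace Ω] (P : Measure Ω) (K : ℝ → ℝ) (X : ℕ → Ω → ℝ)
    (n : ℕ) (h x₀ : ℝ) : ℝ :=
  Real.sqrt ((n : ℝ) * h * variance (kernelDensityEstimator K X n h x₀) P)

/-- The standard normal distribution function `Φ`. -/
def stdNormalCDF (t : ℝ) : ℝ := cdf (gaussianReal 0 1) t

end

/-! ### The standard normal distribution function and its tails -/

/-! The estimator is its mean plus a normalized sum of bounded i.i.d. terms, so the error splits in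
two.

Normal approximation. After centring and division by `√(nh) σ_h`, each summand is at most a constant
times `1 / (√(nh) σ_h)`. A Berry-Esseen bound linear in the uniform bound `δ` of the summands
(`abs_measureReal_sum_le_sub_stdNormalCDF_le`) therefore gives `O((nh)^(-1/2))`, provided `σ_h`
stays away from zero; it does, because `σ_h²` tends to `f x₀ ∫ K²`. The Berry-Esseen bound comes
from Stein's equation `f' w = w f w + 1_{w < z} - Φ z`. Writing `W` for the sum and leaving out one
summand at a time, `E[W f(W)]` is compared with an envelope of `f'` at `W`. The term `E[W f(W)]`
cancels, and the jump of `f'` at `z` is handled by moving the threshold by a multiple of `δ`, so no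
concentration inequality is needed; the Lipschitz property of `Φ` undoes the move.

Bias. A Taylor expansion of `f` at `x₀`, whose odd terms vanish by symmetry of `K`, shows that the
mean is `f x₀ + h² f''(x₀) μ₂ / 2 + O(h⁴)` (`exists_abs_bias_sub_le`). Scaled by `√(nh)` and passed
through the Lipschitz function `Φ`, the remainder costs `O(n^(1/2) h^(9/2))`. -/

lemma stdNormalCDF_eq_integral (x : ℝ) :
    stdNormalCDF x = ∫ t in Set.Iic x, gaussianPDFReal 0 1 t := by
  rw [stdNormalCDF, cdf_eq_real, measureReal_def, gaussianReal_apply_eq_integral _ one_ne_zero,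
    ENNReal.toReal_ofReal]
  exact setIntegral_nonneg measurableSet_Iic fun t _ => gaussianPDFReal_nonneg _ _ _

lemma hasDerivAt_gaussianPDFReal_std (x : ℝ) :
    HasDerivAt (gaussianPDFReal 0 1) (-x * gaussianPDFReal 0 1 x) x := by
  have h : HasDerivAt (fun t : ℝ => -(t - 0) ^ 2 / (2 * ((1 : NNReal) : ℝ))) (-x) x := by
    have := (((hasDerivAt_id x).sub_const 0).pow 2).neg.div_const (2 * ((1 : NNReal) : ℝ))
    refine this.congr_deriv ?_
    simp
    ring
  have := (h.exp).const_mul (√(2 * Real.pi * ((1 : NNReal) : ℝ)))⁻¹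
  rw [gaussianPDFReal_def]
  exact this.congr_deriv (by ring)

lemma continuous_gaussianPDFReal_std : Continuous (gaussianPDFReal 0 1) :=
  continuous_iff_continuousAt.2 fun x => (hasDerivAt_gaussianPDFReal_std x).continuousAt

lemma gaussianPDFReal_std_pos (x : ℝ) : 0 < gaussianPDFReal 0 1 x :=
  gaussianPDFReal_pos _ _ _ one_ne_zero

lemma gaussianPDFReal_std_le_one (x : ℝ) : gaussianPDFReal 0 1 x ≤ 1 := by
  rw [gaussianPDFReal]
  have h1 : Real.exp (-(x - 0) ^ 2 / (2 * ((1 : NNReal) : ℝ))) ≤ 1 := by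
    rw [Real.exp_le_one_iff]
    simp only [NNReal.coe_one]
    nlinarith [sq_nonneg (x - 0)]
  have h2 : (√(2 * Real.pi * ((1 : NNReal) : ℝ)))⁻¹ ≤ 1 := by
    refine inv_le_one_of_one_le₀ (Real.one_le_sqrt.2 ?_)
    simp only [NNReal.coe_one]
    nlinarith [Real.pi_gt_three]
  exact mul_le_one₀ h2 (Real.exp_pos _).le h1

lemma gaussianPDFReal_std_neg (x : ℝ) : gaussianPDFReal 0 1 (-x) = gaussianPDFReal 0 1 x := by
  simp [gaussianPDFReal]

lemma hasDerivAt_stdNormalCDF (x : ℝ) :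
    HasDerivAt stdNormalCDF (gaussianPDFReal 0 1 x) x := by
  have hint : ∀ s, IntegrableOn (gaussianPDFReal 0 1) s := fun s =>
    (integrable_gaussianPDFReal 0 1).integrableOn
  have h : stdNormalCDF = fun u => stdNormalCDF 0 + ∫ t in (0 : ℝ)..u, gaussianPDFReal 0 1 t := by
    funext u
    rw [stdNormalCDF_eq_integral, stdNormalCDF_eq_integral,
      ← intervalIntegral.integral_Iic_sub_Iic (hint _) (hint _)]
    ring
  rw [h]
  exact (intervalIntegral.integral_hasDerivAt_right
    (continuous_gaussianPDFReal_std.intervalIntegrable _ _)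
    (continuous_gaussianPDFReal_std.stronglyMeasurableAtFilter _ _)
    continuous_gaussianPDFReal_std.continuousAt).const_add _

lemma stdNormalCDF_nonneg (x : ℝ) : 0 ≤ stdNormalCDF x := cdf_nonneg _ x

lemma stdNormalCDF_le_one (x : ℝ) : stdNormalCDF x ≤ 1 := cdf_le_one _ x

lemma monotone_stdNormalCDF : Monotone stdNormalCDF := monotone_cdf _

lemma continuous_stdNormalCDF : Continuous stdNormalCDF :=
  continuous_iff_continuousAt.2 fun x => (hasDerivAt_stdNormalCDF x).continuousAt

lemma abs_stdNormalCDF_sub_le (a b : ℝ) : |stdNormalCDF a - stdNormalCDF b| ≤ |a - b| := by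
  have := convex_univ.norm_image_sub_le_of_norm_hasDerivWithin_le (C := 1)
    (fun x _ => (hasDerivAt_stdNormalCDF x).hasDerivWithinAt) (fun x _ => by
      rw [Real.norm_eq_abs, abs_of_pos (gaussianPDFReal_std_pos x)]
      exact gaussianPDFReal_std_le_one x) (Set.mem_univ b) (Set.mem_univ a)
  simpa using this

lemma stdNormalCDF_neg (x : ℝ) : stdNormalCDF (-x) = 1 - stdNormalCDF x := by
  have hd : ∀ t, HasDerivAt (fun u => stdNormalCDF u + stdNormalCDF (-u)) 0 t := fun t => by
    have h := (hasDerivAt_stdNormalCDF t).add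
      ((hasDerivAt_stdNormalCDF (-t)).comp t (hasDerivAt_neg t))
    refine h.congr_deriv ?_
    rw [gaussianPDFReal_std_neg]
    ring
  have hconst : ∀ t, stdNormalCDF t + stdNormalCDF (-t) = stdNormalCDF x + stdNormalCDF (-x) :=
    fun t => is_const_of_deriv_eq_zero (fun s => (hd s).differentiableAt) (fun s => (hd s).deriv)
      t x
  have h1 : Tendsto (fun t => stdNormalCDF t + stdNormalCDF (-t)) atTop (𝓝 (1 + 0)) :=
    (tendsto_cdf_atTop _).add ((tendsto_cdf_atBot _).comp tendsto_neg_atTop_atBot)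
  have h2 := tendsto_nhds_unique (h1.congr hconst) tendsto_const_nhds
  linarith

/-- Mills' bound on the normal tail. -/
lemma one_add_mul_stdNormalCDF_compl_le {x : ℝ} (hx : 0 ≤ x) :
    (1 + x) * (1 - stdNormalCDF x) ≤ 2 * gaussianPDFReal 0 1 x := by
  -- The gap between the two sides is antitone on `[0, ∞)` and tends to zero, hence nonnegative. The
  -- sign of its derivative reduces to `(1 + t)² ≤ 2t² + 2t + 2`.
  set u : ℝ → ℝ := fun t => 2 * gaussianPDFReal 0 1 t / (1 + t) - (1 - stdNormalCDF t) with hu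
  have hd : ∀ t, 0 ≤ t → HasDerivAt u
      ((2 * (-t * gaussianPDFReal 0 1 t) * (1 + t) - 2 * gaussianPDFReal 0 1 t * 1) / (1 + t) ^ 2
        - (0 - gaussianPDFReal 0 1 t)) t := fun t ht =>
    (((hasDerivAt_gaussianPDFReal_std t).const_mul 2).div ((hasDerivAt_id t).const_add 1)
      (by positivity)).sub ((hasDerivAt_const t (1 : ℝ)).sub (hasDerivAt_stdNormalCDF t))
  have hanti : AntitoneOn u (Set.Ici 0) := by
    refine antitoneOn_of_deriv_nonpos (convex_Ici 0)
      (fun t ht => (hd t ht).continuousAt.continuousWithinAt)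
      (fun t ht => (hd t (interior_subset ht)).differentiableAt.differentiableWithinAt)
      fun t ht => ?_
    have ht0 : 0 ≤ t := interior_subset ht
    rw [(hd t ht0).deriv, sub_nonpos, div_le_iff₀ (by positivity)]
    have := gaussianPDFReal_std_pos t
    nlinarith [mul_nonneg this.le (sq_nonneg t), mul_nonneg this.le ht0]
  have hlim : Tendsto u atTop (𝓝 (0 - (1 - 1))) := by
    refine Tendsto.sub ?_ (tendsto_const_nhds.sub (tendsto_cdf_atTop _))
    have h2 : Tendsto (fun t : ℝ => 2 / (1 + t)) atTop (𝓝 0) :=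
      tendsto_const_nhds.div_atTop (tendsto_atTop_add_const_left _ _ tendsto_id)
    refine squeeze_zero' ?_ ?_ h2
    · filter_upwards [eventually_ge_atTop 0] with t ht
      have := gaussianPDFReal_std_pos t
      positivity
    · filter_upwards [eventually_ge_atTop 0] with t ht
      have := gaussianPDFReal_std_le_one t
      gcongr
      linarith
  have h0 : 0 - (1 - 1) ≤ u x := le_of_tendsto hlim (by
    filter_upwards [eventually_ge_atTop x] with t ht
    exact hanti hx (hx.trans ht) ht)
  have h3 : 1 - stdNormalCDF x ≤ 2 * gaussianPDFReal 0 1 x / (1 + x) := by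
    simp only [hu] at h0
    linarith
  rw [le_div_iff₀ (by positivity)] at h3
  linarith

/-! ### The solution of Stein's equation for a half-line -/

/-- The bounded solution of `f' w = w f w + 1_{w < z} - Φ z`. -/
noncomputable def steinSol (z w : ℝ) : ℝ :=
  stdNormalCDF (min w z) * (1 - stdNormalCDF (max w z)) / gaussianPDFReal 0 1 w

/-- The right derivative of `steinSol z`. -/
noncomputable def steinDeriv (z w : ℝ) : ℝ :=
  w * steinSol z w + (Set.Iio z).indicator 1 w - stdNormalCDF z

lemma continuous_steinSol (z : ℝ) : Continuous (steinSol z) := by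
  refine Continuous.div ?_ continuous_gaussianPDFReal_std fun w => (gaussianPDFReal_std_pos w).ne'
  have := continuous_stdNormalCDF
  fun_prop

lemma steinSol_nonneg (z w : ℝ) : 0 ≤ steinSol z w :=
  div_nonneg (mul_nonneg (stdNormalCDF_nonneg _) (sub_nonneg.2 (stdNormalCDF_le_one _)))
    (gaussianPDFReal_std_pos w).le

/-- Of the two factors in the numerator, one is at most 1 and the other at most `1 - Φ |w|`, so
Mills' bound applies. Every later bound on the Stein solution and its derivative rests on this one.
-/
lemma one_add_abs_mul_steinSol_le (z w : ℝ) : (1 + |w|) * steinSol z w ≤ 2 := by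
  have hφ := gaussianPDFReal_std_pos w
  rw [steinSol, ← mul_div_assoc, div_le_iff₀ hφ]
  have a1 := stdNormalCDF_nonneg (min w z)
  have a2 := stdNormalCDF_le_one (min w z)
  have b1 := stdNormalCDF_nonneg (max w z)
  have b2 := stdNormalCDF_le_one (max w z)
  have hpos : 0 ≤ 1 + |w| := by positivity
  have key : (1 + |w|) * (1 - stdNormalCDF |w|) ≤ 2 * gaussianPDFReal 0 1 w := by
    have := one_add_mul_stdNormalCDF_compl_le (abs_nonneg w)
    rcases abs_cases w with ⟨h, -⟩ | ⟨h, -⟩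
    · rwa [h] at this ⊢
    · rw [h, gaussianPDFReal_std_neg] at this
      rwa [h]
  refine le_trans (mul_le_mul_of_nonneg_left ?_ hpos) key
  rcases le_total 0 w with hw | hw
  · have h := monotone_stdNormalCDF (le_max_left w z)
    rw [abs_of_nonneg hw]
    nlinarith
  · have h := monotone_stdNormalCDF (min_le_left w z)
    rw [abs_of_nonpos hw, stdNormalCDF_neg]
    nlinarith

lemma steinSol_le (z w : ℝ) : steinSol z w ≤ 2 := by
  have h1 := one_add_abs_mul_steinSol_le z w
  have h2 := steinSol_nonneg z w
  nlinarith [abs_nonneg w]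

lemma abs_mul_steinSol_le (z w : ℝ) : |w * steinSol z w| ≤ 2 := by
  have h1 := one_add_abs_mul_steinSol_le z w
  have h2 := steinSol_nonneg z w
  rw [abs_mul, abs_of_nonneg h2]
  linarith

lemma abs_steinDeriv_le (z w : ℝ) : |steinDeriv z w| ≤ 3 := by
  have h1 := abs_le.1 (abs_mul_steinSol_le z w)
  have h2 := stdNormalCDF_nonneg z
  have h3 := stdNormalCDF_le_one z
  have h4 : (Set.Iio z).indicator (1 : ℝ → ℝ) w = 1 ∨ (Set.Iio z).indicator (1 : ℝ → ℝ) w = 0 := by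
    by_cases h : w ∈ Set.Iio z <;> simp [h]
  rw [steinDeriv, abs_le]
  rcases h4 with h4 | h4 <;> rw [h4] <;> constructor <;> linarith

/-- The solution has a kink at `w = z`. There the branch `w ≥ z` decides the right derivative, which
is why the indicator is that of the open half-line. -/
lemma hasDerivWithinAt_steinSol (z w : ℝ) :
    HasDerivWithinAt (steinSol z) (steinDeriv z w) (Set.Ici w) w := by
  have hφ := gaussianPDFReal_std_pos w
  rcases lt_or_ge w z with hw | hw
  · have h := ((hasDerivAt_stdNormalCDF w).mul_const (1 - stdNormalCDF z)).div
      (hasDerivAt_gaussianPDFReal_std w) hφ.ne'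
    refine HasDerivAt.hasDerivWithinAt ?_
    have heq : steinSol z =ᶠ[𝓝 w]
        fun t => stdNormalCDF t * (1 - stdNormalCDF z) / gaussianPDFReal 0 1 t := by
      filter_upwards [Iio_mem_nhds hw] with t ht
      rw [steinSol, min_eq_left (le_of_lt ht), max_eq_right (le_of_lt ht)]
    refine HasDerivAt.congr_of_eventuallyEq ?_ heq
    refine h.congr_deriv ?_
    rw [steinDeriv, Set.indicator_of_mem (Set.mem_Iio.2 hw), heq.eq_of_nhds, Pi.one_apply]
    field_simp
    ring
  · have h := (((hasDerivAt_stdNormalCDF w).const_sub 1).const_mul (stdNormalCDF z)).div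
      (hasDerivAt_gaussianPDFReal_std w) hφ.ne'
    have heq : ∀ t ∈ Set.Ici w, steinSol z t
        = stdNormalCDF z * (1 - stdNormalCDF t) / gaussianPDFReal 0 1 t := fun t ht => by
      rw [steinSol, min_eq_right (hw.trans ht), max_eq_left (hw.trans ht)]
    refine HasDerivWithinAt.congr_deriv
      (h.hasDerivWithinAt.congr heq (heq w Set.self_mem_Ici)) ?_
    rw [steinDeriv, Set.indicator_of_notMem (by simpa using hw), heq w Set.self_mem_Ici]
    field_simp
    ring

/-- The mean value inequality in its one-sided form, since two-sided differentiability fails at the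
kink. -/
lemma steinSol_sub_le {z a b C : ℝ} (hab : a ≤ b) (hC : ∀ w ∈ Set.Icc a b, steinDeriv z w ≤ C) :
    steinSol z b - steinSol z a ≤ C * (b - a) := by
  have h := image_le_of_deriv_right_le_deriv_boundary (f := steinSol z) (f' := steinDeriv z)
    (B := fun w => steinSol z a + C * (w - a)) (B' := fun _ => C)
    (continuous_steinSol z).continuousOn (fun x _ => hasDerivWithinAt_steinSol z x) (by simp)
    (by fun_prop) (fun x _ => by
      simpa using ((((hasDerivAt_id x).sub_const a).const_mul C).const_add
        (steinSol z a)).hasDerivWithinAt)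
    (fun x hx => hC x (Set.Ico_subset_Icc_self hx)) (Set.right_mem_Icc.2 hab)
  linarith

lemma le_steinSol_sub {z a b C : ℝ} (hab : a ≤ b) (hC : ∀ w ∈ Set.Icc a b, C ≤ steinDeriv z w) :
    C * (b - a) ≤ steinSol z b - steinSol z a := by
  have h := image_le_of_deriv_right_le_deriv_boundary (B := steinSol z) (B' := steinDeriv z)
    (f := fun w => steinSol z a + C * (w - a)) (f' := fun _ => C)
    (by fun_prop) (fun x _ => by
      simpa using ((((hasDerivAt_id x).sub_const a).const_mul C).const_add
        (steinSol z a)).hasDerivWithinAt) (by simp)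
    (continuous_steinSol z).continuousOn (fun x _ => hasDerivWithinAt_steinSol z x)
    (fun x hx => hC x (Set.Ico_subset_Icc_self hx)) (Set.right_mem_Icc.2 hab)
  linarith

lemma abs_steinSol_sub_le (z a b : ℝ) : |steinSol z a - steinSol z b| ≤ 3 * |a - b| := by
  have key : ∀ a b, a ≤ b → |steinSol z a - steinSol z b| ≤ 3 * |a - b| := fun a b hab => by
    have h1 := steinSol_sub_le hab fun w _ => (abs_le.1 (abs_steinDeriv_le z w)).2
    have h2 := le_steinSol_sub hab fun w _ => (abs_le.1 (abs_steinDeriv_le z w)).1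
    rw [abs_sub_comm a b, abs_of_nonneg (sub_nonneg.2 hab), abs_le]
    constructor <;> linarith
  rcases le_total a b with h | h
  · exact key a b h
  · rw [abs_sub_comm, abs_sub_comm a b]
    exact key b a h

lemma abs_mul_steinSol_sub_le (z a b : ℝ) :
    |a * steinSol z a - b * steinSol z b| ≤ (3 * |a| + 2) * |a - b| := by
  have h : a * steinSol z a - b * steinSol z b
      = a * (steinSol z a - steinSol z b) + (a - b) * steinSol z b := by ring
  rw [h]
  refine (abs_add_le _ _).trans ?_
  rw [abs_mul, abs_mul, abs_of_nonneg (steinSol_nonneg z b)]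
  have h1 := mul_le_mul_of_nonneg_left (abs_steinSol_sub_le z a b) (abs_nonneg a)
  have h2 := mul_le_mul_of_nonneg_left (steinSol_le z b) (abs_nonneg (a - b))
  linarith

/-! ### Berry-Esseen bound for bounded summands, by Stein's method -/

section BoundedSummands

variable {Ω : Type*} [MeasurableSpace Ω] {P : Measure Ω} [IsProbabilityMeasure P]

lemma integrable_comp_of_linear_growth {Y : Ω → ℝ} (hY : Measurable Y) {R : ℝ}
    (hYR : ∀ ω, |Y ω| ≤ R) {F : ℝ → ℝ} (hF : Measurable F) {c : ℝ}
    (hFc : ∀ v, |F v| ≤ c * (1 + |v|)) : Integrable (fun ω => F (Y ω)) P := by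
  have hc : 0 ≤ c := by simpa using (abs_nonneg _).trans (hFc 0)
  refine Integrable.of_bound (hF.comp hY).aestronglyMeasurable (c * (1 + R)) (ae_of_all _ fun ω => ?_)
  refine (hFc _).trans ?_
  have := hYR ω
  gcongr

/-- With `W` the sum and `W' = W - ξ i`, independence and centring give `E[ξ i F(W')] = 0`, so `E[ξ
i F(W)] = E[ξ i (F(W) - F(W'))]`. This is at most `E[ξ i ² G(W')] = E[ξ i ²] E[G(W')]`, again by
independence, and `H` brings the argument back to `W`. Summing over `i` uses unit total variance. -/
lemma integral_sum_mul_le_of_leave_one_out {ι : Type*} {ξ : ι → Ω → ℝ}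
    (hmeas : ∀ i, Measurable (ξ i)) (hindep : iIndepFun ξ P) {δ : ℝ}
    (hbdd : ∀ i ω, |ξ i ω| ≤ δ) (hmean : ∀ i, ∫ ω, ξ i ω ∂P = 0) {s : Finset ι}
    (hvar : ∑ i ∈ s, ∫ ω, ξ i ω ^ 2 ∂P = 1) {F G H : ℝ → ℝ} {c : ℝ}
    (hF : Measurable F) (hFc : ∀ v, |F v| ≤ c * (1 + |v|))
    (hG : Measurable G) (hGc : ∀ v, |G v| ≤ c * (1 + |v|))
    (hH : Measurable H) (hHc : ∀ v, |H v| ≤ c * (1 + |v|))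
    (hFG : ∀ v x, |x| ≤ δ → x * (F (v + x) - F v) ≤ x ^ 2 * G v)
    (hGH : ∀ v x, |x| ≤ δ → G v ≤ H (v + x)) :
    ∫ ω, (∑ i ∈ s, ξ i ω) * F (∑ i ∈ s, ξ i ω) ∂P ≤ ∫ ω, H (∑ i ∈ s, ξ i ω) ∂P := by
  classical
  have hmeasSum : ∀ t : Finset ι, Measurable fun ω => ∑ i ∈ t, ξ i ω := fun t =>
    Finset.measurable_fun_sum t fun i _ => hmeas i
  have hbddSum : ∀ (t : Finset ι) ω, |∑ i ∈ t, ξ i ω| ≤ t.card * δ := fun t ω => by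
    refine (Finset.abs_sum_le_sum_abs _ _).trans ?_
    simpa using Finset.sum_le_card_nsmul t _ δ fun i _ => hbdd i ω
  have hintF : ∀ t : Finset ι, Integrable (fun ω => F (∑ i ∈ t, ξ i ω)) P := fun t =>
    integrable_comp_of_linear_growth (hmeasSum t) (hbddSum t) hF hFc
  have hintG : ∀ t : Finset ι, Integrable (fun ω => G (∑ i ∈ t, ξ i ω)) P := fun t =>
    integrable_comp_of_linear_growth (hmeasSum t) (hbddSum t) hG hGc
  have hintH : Integrable (fun ω => H (∑ i ∈ s, ξ i ω)) P :=
    integrable_comp_of_linear_growth (hmeasSum s) (hbddSum s) hH hHc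
  have hmulF : ∀ i (t : Finset ι), Integrable (fun ω => ξ i ω * F (∑ i ∈ t, ξ i ω)) P :=
    fun i t => (hintF t).bdd_mul (hmeas i).aestronglyMeasurable (ae_of_all _ (hbdd i))
  have hsq : ∀ i, Measurable fun ω => ξ i ω ^ 2 := fun i => (hmeas i).pow_const 2
  have hmulG : ∀ i (t : Finset ι), Integrable (fun ω => ξ i ω ^ 2 * G (∑ i ∈ t, ξ i ω)) P :=
    fun i t => (hintG t).bdd_mul (c := δ ^ 2) (hsq i).aestronglyMeasurable (ae_of_all _ fun ω => by
      rw [Real.norm_eq_abs, abs_pow]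
      exact pow_le_pow_left₀ (abs_nonneg _) (hbdd i ω) 2)
  have key : ∀ i ∈ s, ∫ ω, ξ i ω * F (∑ j ∈ s, ξ j ω) ∂P
      ≤ (∫ ω, ξ i ω ^ 2 ∂P) * ∫ ω, H (∑ j ∈ s, ξ j ω) ∂P := by
    intro i hi
    have hsplit : ∀ ω, ∑ j ∈ s, ξ j ω = ∑ j ∈ s.erase i, ξ j ω + ξ i ω := fun ω =>
      (Finset.sum_erase_add s _ hi).symm
    have hind : IndepFun (ξ i) (fun ω => ∑ j ∈ s.erase i, ξ j ω) P := by
      have := (hindep.indepFun_finsetSum_of_notMem hmeas (Finset.notMem_erase i s)).symm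
      convert this using 1
      ext ω
      simp
    have e1 : ∫ ω, ξ i ω * F (∑ j ∈ s.erase i, ξ j ω) ∂P = 0 := by
      have := (hind.comp measurable_id hF).integral_fun_mul_eq_mul_integral
        (hmeas i).aestronglyMeasurable (hintF _).aestronglyMeasurable
      simp only [Function.comp_def, id] at this
      rw [this, hmean, zero_mul]
    have e2 : ∫ ω, ξ i ω ^ 2 * G (∑ j ∈ s.erase i, ξ j ω) ∂P
        = (∫ ω, ξ i ω ^ 2 ∂P) * ∫ ω, G (∑ j ∈ s.erase i, ξ j ω) ∂P :=
      (hind.comp (measurable_id.pow_const 2) hG).integral_fun_mul_eq_mul_integral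
        (hsq i).aestronglyMeasurable (hintG _).aestronglyMeasurable
    calc ∫ ω, ξ i ω * F (∑ j ∈ s, ξ j ω) ∂P
        = ∫ ω, (ξ i ω * F (∑ j ∈ s, ξ j ω) - ξ i ω * F (∑ j ∈ s.erase i, ξ j ω)) ∂P := by
          rw [integral_sub (hmulF i s) (hmulF i _), e1, sub_zero]
      _ ≤ ∫ ω, ξ i ω ^ 2 * G (∑ j ∈ s.erase i, ξ j ω) ∂P := by
          refine integral_mono ((hmulF i s).sub (hmulF i _)) (hmulG i _) fun ω => ?_
          have := hFG (∑ j ∈ s.erase i, ξ j ω) _ (hbdd i ω)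
          rw [← hsplit] at this
          simpa [mul_sub] using this
      _ = (∫ ω, ξ i ω ^ 2 ∂P) * ∫ ω, G (∑ j ∈ s.erase i, ξ j ω) ∂P := e2
      _ ≤ _ := by
          refine mul_le_mul_of_nonneg_left (integral_mono (hintG _) hintH fun ω => ?_)
            (integral_nonneg fun ω => sq_nonneg _)
          have := hGH (∑ j ∈ s.erase i, ξ j ω) _ (hbdd i ω)
          rwa [← hsplit] at this
  calc ∫ ω, (∑ i ∈ s, ξ i ω) * F (∑ i ∈ s, ξ i ω) ∂P
      = ∑ i ∈ s, ∫ ω, ξ i ω * F (∑ j ∈ s, ξ j ω) ∂P := by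
        rw [← integral_finsetSum s fun i _ => hmulF i s]
        exact integral_congr_ae (ae_of_all _ fun ω => Finset.sum_mul _ _ _)
    _ ≤ ∑ i ∈ s, (∫ ω, ξ i ω ^ 2 ∂P) * ∫ ω, H (∑ j ∈ s, ξ j ω) ∂P := Finset.sum_le_sum key
    _ = _ := by rw [← Finset.sum_mul, hvar, one_mul]

lemma indicator_one_cases (t : Set ℝ) (v : ℝ) :
    (v ∈ t ∧ t.indicator (1 : ℝ → ℝ) v = 1) ∨ (v ∉ t ∧ t.indicator (1 : ℝ → ℝ) v = 0) := by
  by_cases h : v ∈ t <;> simp [h]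

/-- Bounds the derivative over a whole `δ`-window by a function of its centre `v`: the product `w
f(w)` moves by its local Lipschitz bound, and `w < z` forces `v < z + δ`. -/
lemma steinDeriv_le {z δ v w : ℝ} (h : |v - w| ≤ δ) :
    steinDeriv z w ≤ v * steinSol z v + (3 * |v| + 2) * δ + (Set.Iio (z + δ)).indicator 1 v
      - stdNormalCDF z := by
  have h1 := abs_mul_steinSol_sub_le z v w
  have h2 := mul_le_mul_of_nonneg_left h (by positivity : 0 ≤ 3 * |v| + 2)
  have h3 := abs_le.1 h1
  have h4 := abs_le.1 h
  rw [steinDeriv]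
  rcases indicator_one_cases (Set.Iio z) w with ⟨a, a'⟩ | ⟨a, a'⟩ <;>
  rcases indicator_one_cases (Set.Iio (z + δ)) v with ⟨b, b'⟩ | ⟨b, b'⟩ <;>
  rw [a', b'] <;> simp only [Set.mem_Iio] at a b <;> linarith

lemma le_steinDeriv {z δ v w : ℝ} (h : |v - w| ≤ δ) :
    v * steinSol z v - (3 * |v| + 2) * δ + (Set.Iio (z - δ)).indicator 1 v
      - stdNormalCDF z ≤ steinDeriv z w := by
  have h1 := abs_mul_steinSol_sub_le z v w
  have h2 := mul_le_mul_of_nonneg_left h (by positivity : 0 ≤ 3 * |v| + 2)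
  have h3 := abs_le.1 h1
  have h4 := abs_le.1 h
  rw [steinDeriv]
  rcases indicator_one_cases (Set.Iio z) w with ⟨a, a'⟩ | ⟨a, a'⟩ <;>
  rcases indicator_one_cases (Set.Iio (z - δ)) v with ⟨b, b'⟩ | ⟨b, b'⟩ <;>
  rw [a', b'] <;> simp only [Set.mem_Iio] at a b <;> linarith

lemma mul_steinSol_sub_le {z v x C : ℝ} (h : ∀ w, |v - w| ≤ |x| → steinDeriv z w ≤ C) :
    x * (steinSol z (v + x) - steinSol z v) ≤ x ^ 2 * C := by
  rcases le_total 0 x with hx | hx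
  · have := steinSol_sub_le (z := z) (a := v) (b := v + x) (C := C) (by linarith) fun w hw => h w (by
      rw [abs_of_nonneg hx, abs_le]; constructor <;> linarith [hw.1, hw.2])
    nlinarith
  · have := steinSol_sub_le (z := z) (a := v + x) (b := v) (C := C) (by linarith) fun w hw => h w (by
      rw [abs_of_nonpos hx, abs_le]; constructor <;> linarith [hw.1, hw.2])
    nlinarith

lemma le_mul_steinSol_sub {z v x C : ℝ} (h : ∀ w, |v - w| ≤ |x| → C ≤ steinDeriv z w) :
    x ^ 2 * C ≤ x * (steinSol z (v + x) - steinSol z v) := by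
  rcases le_total 0 x with hx | hx
  · have := le_steinSol_sub (z := z) (a := v) (b := v + x) (C := C) (by linarith) fun w hw => h w (by
      rw [abs_of_nonneg hx, abs_le]; constructor <;> linarith [hw.1, hw.2])
    nlinarith
  · have := le_steinSol_sub (z := z) (a := v + x) (b := v) (C := C) (by linarith) fun w hw => h w (by
      rw [abs_of_nonpos hx, abs_le]; constructor <;> linarith [hw.1, hw.2])
    nlinarith

/-- Serves only integrability; the constants 6 and 7 cover all envelopes used below. -/
lemma abs_stein_majorant_le {z a b δ : ℝ} (ha : |a| ≤ 6) (hb : |b| ≤ 7) (hδ : 0 ≤ δ) (hδ1 : δ ≤ 1)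
    (t : Set ℝ) (v : ℝ) :
    |v * steinSol z v + (a * |v| + b) * δ + t.indicator 1 v - stdNormalCDF z|
      ≤ 11 * (1 + |v|) := by
  have h1 := abs_le.1 (abs_mul_steinSol_le z v)
  have h2 := stdNormalCDF_nonneg z
  have h3 := stdNormalCDF_le_one z
  have hv := abs_nonneg v
  have h4 : |(a * |v| + b) * δ| ≤ 6 * |v| + 7 := by
    rw [abs_mul, abs_of_nonneg hδ]
    have : |a * |v| + b| ≤ 6 * |v| + 7 := by
      refine (abs_add_le _ _).trans ?_
      rw [abs_mul, abs_abs]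
      gcongr
    calc |a * |v| + b| * δ ≤ |a * |v| + b| * 1 := by gcongr
      _ ≤ _ := by linarith
  have h4 := abs_le.1 h4
  rw [abs_le]
  rcases indicator_one_cases t v with ⟨-, a'⟩ | ⟨-, a'⟩ <;> rw [a'] <;> constructor <;> linarith

lemma measurable_stein_majorant (z a b δ : ℝ) {t : Set ℝ} (ht : MeasurableSet t) :
    Measurable fun v => v * steinSol z v + (a * |v| + b) * δ + t.indicator 1 v - stdNormalCDF z := by
  have h1 : Measurable (steinSol z) := (continuous_steinSol z).measurable
  have h2 : Measurable (t.indicator (1 : ℝ → ℝ)) := measurable_one.indicator ht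
  have h3 : Measurable fun v : ℝ => |v| := continuous_abs.measurable
  exact (((measurable_id.mul h1).add (((h3.const_mul a).add_const b).mul_const δ)).add
    h2).sub_const _

/-- Moving from `v` to `v + x` costs `3|v + x| + 2` for the product term, and `3|v| + 2 ≤ 3|v + x| +
5` since `|x| ≤ 1`; together these make `6|v + x| + 7`. -/
lemma stein_majorant_le_add {z δ v x : ℝ} (hx : |x| ≤ δ) (hδ1 : δ ≤ 1) :
    v * steinSol z v + (3 * |v| + 2) * δ + (Set.Iio (z + δ)).indicator 1 v - stdNormalCDF z
      ≤ (v + x) * steinSol z (v + x) + (6 * |v + x| + 7) * δ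
        + (Set.Iic (z + 2 * δ)).indicator 1 (v + x) - stdNormalCDF z := by
  have hδ : 0 ≤ δ := (abs_nonneg _).trans hx
  have h1 := abs_le.1 (abs_mul_steinSol_sub_le z (v + x) v)
  rw [add_sub_cancel_left] at h1
  have h2 := mul_le_mul_of_nonneg_left hx (by positivity : 0 ≤ 3 * |v + x| + 2)
  have h3 : |v| ≤ |v + x| + |x| := by
    simpa using abs_sub (v + x) x
  have h4 := mul_le_mul_of_nonneg_right (h3.trans (add_le_add_right (hx.trans hδ1) _)) hδ
  have h5 := abs_le.1 hx
  rcases indicator_one_cases (Set.Iio (z + δ)) v with ⟨a, a'⟩ | ⟨a, a'⟩ <;>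
  rcases indicator_one_cases (Set.Iic (z + 2 * δ)) (v + x) with ⟨b, b'⟩ | ⟨b, b'⟩ <;>
  rw [a', b'] <;> simp only [Set.mem_Iio, Set.mem_Iic] at a b <;> nlinarith

/-- The shift is `3δ`, not `2δ`: the closed condition at `v + x` must imply the strict one `v < z -
δ`, which the spare `δ > 0` secures. -/
lemma stein_minorant_add_le {z δ v x : ℝ} (hx : |x| ≤ δ) (hδ0 : 0 < δ) (hδ1 : δ ≤ 1) :
    (v + x) * steinSol z (v + x) + (-6 * |v + x| + -7) * δ
        + (Set.Iic (z - 3 * δ)).indicator 1 (v + x) - stdNormalCDF z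
      ≤ v * steinSol z v + (-3 * |v| + -2) * δ + (Set.Iio (z - δ)).indicator 1 v
        - stdNormalCDF z := by
  have h1 := abs_le.1 (abs_mul_steinSol_sub_le z (v + x) v)
  rw [add_sub_cancel_left] at h1
  have h2 := mul_le_mul_of_nonneg_left hx (by positivity : 0 ≤ 3 * |v + x| + 2)
  have h3 : |v| ≤ |v + x| + |x| := by
    simpa using abs_sub (v + x) x
  have h4 := mul_le_mul_of_nonneg_right (h3.trans (add_le_add_right (hx.trans hδ1) _)) hδ0.le
  have h5 := abs_le.1 hx
  rcases indicator_one_cases (Set.Iio (z - δ)) v with ⟨a, a'⟩ | ⟨a, a'⟩ <;>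
  rcases indicator_one_cases (Set.Iic (z - 3 * δ)) (v + x) with ⟨b, b'⟩ | ⟨b, b'⟩ <;>
  rw [a', b'] <;> simp only [Set.mem_Iio, Set.mem_Iic] at a b <;> nlinarith

lemma integral_abs_sum_le {ι : Type*} {ξ : ι → Ω → ℝ}
    (hmeas : ∀ i, Measurable (ξ i)) (hindep : iIndepFun ξ P) {δ : ℝ}
    (hbdd : ∀ i ω, |ξ i ω| ≤ δ) (hmean : ∀ i, ∫ ω, ξ i ω ∂P = 0) {s : Finset ι}
    (hvar : ∑ i ∈ s, ∫ ω, ξ i ω ^ 2 ∂P = 1) :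
    ∫ ω, |∑ i ∈ s, ξ i ω| ∂P ≤ 2 := by
  have hL : ∀ i, MemLp (ξ i) 2 P := fun i =>
    MemLp.of_bound (hmeas i).aestronglyMeasurable δ (ae_of_all _ (hbdd i))
  have hLs : MemLp (fun ω => ∑ i ∈ s, ξ i ω) 2 P := memLp_finsetSum s fun i _ => hL i
  have hm : ∫ ω, (∑ i ∈ s, ξ i ω) ∂P = 0 := by
    rw [integral_finsetSum s fun i _ => (hL i).integrable one_le_two]
    simp [hmean]
  have hv : ∫ ω, (∑ i ∈ s, ξ i ω) ^ 2 ∂P = 1 := by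
    have h1 := IndepFun.variance_sum (s := s) (fun i _ => hL i)
      (fun i _ j _ hij => hindep.indepFun hij)
    have h2 : ∑ i ∈ s, ξ i = fun ω => ∑ i ∈ s, ξ i ω := by ext ω; simp
    rw [h2, variance_of_integral_eq_zero hLs.aestronglyMeasurable.aemeasurable hm] at h1
    rw [h1, ← hvar]
    exact Finset.sum_congr rfl fun i _ =>
      variance_of_integral_eq_zero (hmeas i).aemeasurable (hmean i)
  have hi := hLs.integrable_sq
  -- The elementary bound `|w| ≤ 1 + w²` with unit variance gives the constant 2.
  calc ∫ ω, |∑ i ∈ s, ξ i ω| ∂P ≤ ∫ ω, (1 + (∑ i ∈ s, ξ i ω) ^ 2) ∂P := by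
        refine integral_mono (hLs.integrable one_le_two).abs ((integrable_const _).add hi)
          fun ω => ?_
        simp only
        rw [← sq_abs (∑ i ∈ s, ξ i ω)]
        nlinarith [sq_nonneg (|∑ i ∈ s, ξ i ω| - 1)]
    _ = 2 := by
        rw [integral_add (integrable_const _) hi, hv]
        norm_num

/-- Berry-Esseen bound for sums of independent centred summands bounded by `δ`. -/
theorem abs_measureReal_sum_le_sub_stdNormalCDF_le {ι : Type*} {ξ : ι → Ω → ℝ}
    (hmeas : ∀ i, Measurable (ξ i)) (hindep : iIndepFun ξ P) {δ : ℝ} (hδ0 : 0 < δ) (hδ1 : δ ≤ 1)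
    (hbdd : ∀ i ω, |ξ i ω| ≤ δ) (hmean : ∀ i, ∫ ω, ξ i ω ∂P = 0) {s : Finset ι}
    (hvar : ∑ i ∈ s, ∫ ω, ξ i ω ^ 2 ∂P = 1) (z : ℝ) :
    |P.real {ω | ∑ i ∈ s, ξ i ω ≤ z} - stdNormalCDF z| ≤ 22 * δ := by
  have hmeasSum : Measurable fun ω => ∑ i ∈ s, ξ i ω := Finset.measurable_fun_sum s fun i _ => hmeas i
  have hbddSum : ∀ ω, |∑ i ∈ s, ξ i ω| ≤ s.card * δ := fun ω => by
    refine (Finset.abs_sum_le_sum_abs _ _).trans ?_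
    simpa using Finset.sum_le_card_nsmul s _ δ fun i _ => hbdd i ω
  have hF : ∀ z, Measurable (steinSol z) := fun z => (continuous_steinSol z).measurable
  have hFc : ∀ z v, |steinSol z v| ≤ 11 * (1 + |v|) := fun z v => by
    rw [abs_of_nonneg (steinSol_nonneg z v)]
    linarith [steinSol_le z v, abs_nonneg v]
  have habs := integral_abs_sum_le hmeas hindep hbdd hmean hvar
  have hiabs : Integrable (fun ω => |∑ i ∈ s, ξ i ω|) P :=
    integrable_comp_of_linear_growth hmeasSum hbddSum continuous_abs.measurable (c := 1)
      fun v => by rw [abs_abs]; linarith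
  have hiF : ∀ z, Integrable (fun ω => (∑ i ∈ s, ξ i ω) * steinSol z (∑ i ∈ s, ξ i ω)) P := fun z =>
    integrable_comp_of_linear_growth (F := fun v => v * steinSol z v) (c := 2) hmeasSum hbddSum
      (measurable_id.mul (hF z)) fun v => by
        linarith [abs_mul_steinSol_le z v, abs_nonneg v]
  have hset : ∀ t : ℝ, MeasurableSet {ω | ∑ i ∈ s, ξ i ω ≤ t} := fun t =>
    measurableSet_le hmeasSum measurable_const
  have hind : ∀ t, (fun ω => (Set.Iic t).indicator (1 : ℝ → ℝ) (∑ i ∈ s, ξ i ω))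
      = {ω | ∑ i ∈ s, ξ i ω ≤ t}.indicator 1 := fun t => by
    ext ω
    by_cases h : ∑ i ∈ s, ξ i ω ≤ t <;> simp [h]
  have hval : ∀ z a b t : ℝ, ∫ ω, ((∑ i ∈ s, ξ i ω) * steinSol z (∑ i ∈ s, ξ i ω)
        + (a * |∑ i ∈ s, ξ i ω| + b) * δ + (Set.Iic t).indicator 1 (∑ i ∈ s, ξ i ω)
        - stdNormalCDF z) ∂P
      = ∫ ω, (∑ i ∈ s, ξ i ω) * steinSol z (∑ i ∈ s, ξ i ω) ∂P
        + (a * ∫ ω, |∑ i ∈ s, ξ i ω| ∂P + b) * δ + P.real {ω | ∑ i ∈ s, ξ i ω ≤ t}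
        - stdNormalCDF z := fun z a b t => by
    have i1 : Integrable (fun ω => (a * |∑ i ∈ s, ξ i ω| + b) * δ) P :=
      ((hiabs.const_mul a).add (integrable_const b)).mul_const δ
    have i2 : Integrable (fun ω => (Set.Iic t).indicator (1 : ℝ → ℝ) (∑ i ∈ s, ξ i ω)) P := by
      rw [hind]
      exact (integrable_const (1 : ℝ)).indicator (hset t)
    have i3 : Integrable (fun ω => (∑ i ∈ s, ξ i ω) * steinSol z (∑ i ∈ s, ξ i ω)
        + (a * |∑ i ∈ s, ξ i ω| + b) * δ) P := (hiF z).add i1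
    have i4 : Integrable (fun ω => (∑ i ∈ s, ξ i ω) * steinSol z (∑ i ∈ s, ξ i ω)
        + (a * |∑ i ∈ s, ξ i ω| + b) * δ + (Set.Iic t).indicator 1 (∑ i ∈ s, ξ i ω)) P :=
      i3.add i2
    rw [integral_sub i4 (integrable_const _), integral_add i3 i2, integral_add (hiF z) i1,
      integral_mul_const, integral_add (hiabs.const_mul a) (integrable_const b), integral_const_mul, hind,
      integral_indicator_one (hset t)]
    simp
  have upper : ∀ z, stdNormalCDF z ≤ P.real {ω | ∑ i ∈ s, ξ i ω ≤ z + 2 * δ} + 19 * δ := by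
    intro z
    have h := integral_sum_mul_le_of_leave_one_out hmeas hindep hbdd hmean hvar (hF z) (hFc z)
      (measurable_stein_majorant z 3 2 δ (measurableSet_Iio (a := z + δ)))
      (abs_stein_majorant_le (by norm_num) (by norm_num) hδ0.le hδ1 _)
      (measurable_stein_majorant z 6 7 δ (measurableSet_Iic (a := z + 2 * δ)))
      (abs_stein_majorant_le (by norm_num) (by norm_num) hδ0.le hδ1 _)
      (fun v x hx => mul_steinSol_sub_le fun w hw => steinDeriv_le (hw.trans hx))
      (fun v x hx => stein_majorant_le_add hx hδ1)
    -- The integral of `W f(W)` occurs on both sides and cancels; `E|W| ≤ 2` turns `6 E|W| + 7` into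
    -- 19.
    rw [hval] at h
    nlinarith
  have lower : ∀ z, P.real {ω | ∑ i ∈ s, ξ i ω ≤ z - 3 * δ} ≤ stdNormalCDF z + 19 * δ := by
    intro z
    have h := integral_sum_mul_le_of_leave_one_out (F := fun v => -steinSol z v)
      hmeas hindep hbdd hmean hvar (hF z).neg (fun v => by rw [abs_neg]; exact hFc z v)
      (measurable_stein_majorant z (-3) (-2) δ (measurableSet_Iio (a := z - δ))).neg
      (fun v => by
        rw [Pi.neg_apply, abs_neg]
        exact abs_stein_majorant_le (by norm_num) (by norm_num) hδ0.le hδ1 _ v)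
      (measurable_stein_majorant z (-6) (-7) δ (measurableSet_Iic (a := z - 3 * δ))).neg
      (fun v => by
        rw [Pi.neg_apply, abs_neg]
        exact abs_stein_majorant_le (by norm_num) (by norm_num) hδ0.le hδ1 _ v)
      (fun v x hx => by
        have := le_mul_steinSol_sub (z := z) (v := v) (x := x)
          fun w hw => le_steinDeriv (hw.trans hx)
        simp only [Pi.neg_apply]
        linarith)
      (fun v x hx => neg_le_neg (stein_minorant_add_le hx hδ0 hδ1))
    simp only [Pi.neg_apply, mul_neg, integral_neg] at h
    have h2 := hval z (-6) (-7) (z - 3 * δ)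
    rw [h2] at h
    nlinarith
  -- Recentring the thresholds costs at most `3δ` because `Φ` is 1-Lipschitz, whence `19 + 3 = 22`.
  have h1 := upper (z - 2 * δ)
  have h2 := lower (z + 3 * δ)
  rw [sub_add_cancel] at h1
  rw [add_sub_cancel_right] at h2
  have h3 := abs_le.1 (abs_stdNormalCDF_sub_le z (z - 2 * δ))
  have h4 := abs_le.1 (abs_stdNormalCDF_sub_le (z + 3 * δ) z)
  rw [sub_sub_cancel, abs_of_pos (by linarith)] at h3
  rw [add_sub_cancel_left, abs_of_pos (by linarith)] at h4
  rw [abs_le]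
  constructor <;> linarith

end BoundedSummands

/-! ### Bias and variance of the kernel density estimator -/

lemma integral_comp_standardize {Ω : Type*} [MeasurableSpace Ω] {P : Measure Ω} {Y : Ω → ℝ}
    (hY : Measurable Y) {f : ℝ → ℝ} (hfmeas : Measurable f) (hfnonneg : ∀ x, 0 ≤ f x)
    (hfdens : P.map Y = volume.withDensity fun x => ENNReal.ofReal (f x))
    {G : ℝ → ℝ} (hG : Measurable G) (x₀ : ℝ) {h : ℝ} (hh : 0 < h) :
    ∫ ω, G ((Y ω - x₀) / h) ∂P = h * ∫ u, G u * f (x₀ + h * u) := by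
  have hGm : Measurable fun x => G ((x - x₀) / h) := hG.comp (by fun_prop)
  calc ∫ ω, G ((Y ω - x₀) / h) ∂P = ∫ x, G ((x - x₀) / h) ∂(P.map Y) :=
        (integral_map hY.aemeasurable hGm.aestronglyMeasurable).symm
    _ = ∫ x, f x * G ((x - x₀) / h) := by
        rw [hfdens, integral_withDensity_eq_integral_toReal_smul hfmeas.ennreal_ofReal
          (ae_of_all _ fun _ => ENNReal.ofReal_lt_top)]
        simp only [ENNReal.toReal_ofReal (hfnonneg _), smul_eq_mul]
    _ = ∫ v, f (x₀ + v) * G (v / h) := by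
        rw [← integral_add_left_eq_self _ x₀]
        simp
    _ = h * ∫ u, f (x₀ + h * u) * G (h * u / h) := by
        rw [Measure.integral_comp_mul_left (fun v => f (x₀ + v) * G (v / h)) h, smul_eq_mul, abs_inv,
          abs_of_pos hh, mul_inv_cancel_left₀ hh.ne']
    _ = _ := by
        simp only [mul_div_cancel_left₀ _ hh.ne', mul_comm]

/-- Away from the origin every lower power of `v` is dominated by `v⁴`; this makes the local Taylor
bound global. -/
lemma abs_cubic_le {a b c d ε v : ℝ} (hε : 0 < ε) (hv : ε ≤ |v|) :
    |a + b * v + c * v ^ 2 + d * v ^ 3|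
      ≤ (|a| / ε ^ 4 + |b| / ε ^ 3 + |c| / ε ^ 2 + |d| / ε) * v ^ 4 := by
  have hv4 : v ^ 4 = |v| ^ 4 := by rw [← abs_pow, abs_of_nonneg (by positivity)]
  have hstep : ∀ (e : ℝ) (k l : ℕ), k + l = 4 → |e * v ^ k| ≤ |e| / ε ^ l * v ^ 4 := by
    intro e k l hkl
    rw [abs_mul, abs_pow, hv4, ← hkl, pow_add, div_mul_eq_mul_div,
      le_div_iff₀ (by positivity), mul_assoc]
    gcongr
  have h0 := hstep a 0 4 rfl
  have h1 := hstep b 1 3 rfl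
  have h2 := hstep c 2 2 rfl
  have h3 := hstep d 3 1 rfl
  simp only [pow_zero, mul_one, pow_one] at h0 h1 h2 h3
  have t1 := abs_add_le (a + b * v + c * v ^ 2) (d * v ^ 3)
  have t2 := abs_add_le (a + b * v) (c * v ^ 2)
  have t3 := abs_add_le a (b * v)
  linarith

/-- A bounded function that is `C⁴` at a point differs from its cubic Taylor polynomial there by
a multiple of `v ^ 4`, globally. -/
lemma exists_abs_sub_cubic_taylor_le {f : ℝ → ℝ} {x₀ : ℝ} (hf : ContDiffAt ℝ 4 f x₀)
    {M : ℝ} (hM : ∀ x, |f x| ≤ M) :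
    ∃ a b C : ℝ, ∀ v, |f (x₀ + v)
      - (f x₀ + a * v + iteratedDeriv 2 f x₀ / 2 * v ^ 2 + b * v ^ 3)| ≤ C * v ^ 4 := by
  obtain ⟨u, hu, hfu⟩ := hf.contDiffOn (m := 4) le_rfl (by simp)
  obtain ⟨η, hη, hηu⟩ := Metric.mem_nhds_iff.1 hu
  have hxs : x₀ ∈ Metric.ball x₀ η := Metric.mem_ball_self hη
  have hso : IsOpen (Metric.ball x₀ η) := Metric.isOpen_ball
  have hT := taylor_isLittleO (n := 4) (convex_ball x₀ η) hxs (hfu.mono hηu)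
  rw [hso.nhdsWithin_eq hxs] at hT
  obtain ⟨ε, hε, hT⟩ := Metric.eventually_nhds_iff.1 (hT.bound one_pos)
  have hd : ∀ k, iteratedDerivWithin k f (Metric.ball x₀ η) x₀ = iteratedDeriv k f x₀ := fun k =>
    iteratedDerivWithin_of_isOpen hso hxs
  set a := iteratedDeriv 1 f x₀
  set b := iteratedDeriv 3 f x₀ / 6
  set e := iteratedDeriv 4 f x₀ / 24
  set c := iteratedDeriv 2 f x₀ / 2
  -- Peano's remainder at order four is at most `v⁴` near zero; the quartic Taylor term itself is
  -- moved into the error, adding `|e|`.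
  have hloc : ∀ v, |v| < ε → |f (x₀ + v) - (f x₀ + a * v + c * v ^ 2 + b * v ^ 3)|
      ≤ (1 + |e|) * v ^ 4 := by
    intro v hv
    have h := hT (y := x₀ + v) (by simpa [Real.dist_eq] using hv)
    rw [taylor_within_apply] at h
    simp only [Finset.sum_range_succ, Finset.sum_range_zero, hd, add_sub_cancel_left, smul_eq_mul,
      Real.norm_eq_abs, iteratedDeriv_zero, Nat.factorial] at h
    have h4 : |v ^ 4| = v ^ 4 := abs_of_nonneg (by positivity)
    rw [one_mul, h4] at h
    have h5 : |e * v ^ 4| = |e| * v ^ 4 := by rw [abs_mul, h4]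
    have h6 := abs_add_le _ _ |>.trans (add_le_add h h5.le)
    refine le_trans (le_of_eq ?_) (h6.trans (le_of_eq (by ring)))
    congr 1
    simp only [a, b, c, e]
    push_cast
    ring
  have hglob : ∀ v, ε ≤ |v| → |f (x₀ + v) - (f x₀ + a * v + c * v ^ 2 + b * v ^ 3)|
      ≤ ((2 * M) / ε ^ 4 + |a| / ε ^ 3 + |c| / ε ^ 2 + |b| / ε) * v ^ 4 := by
    intro v hv
    have h := abs_cubic_le (a := f (x₀ + v) - f x₀) (b := -a) (c := -c) (d := -b) hε hv
    have h2 : |f (x₀ + v) - f x₀| ≤ 2 * M := (abs_sub _ _).trans (by linarith [hM (x₀ + v), hM x₀])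
    rw [abs_neg, abs_neg, abs_neg] at h
    refine le_trans (le_of_eq ?_) (h.trans ?_)
    · congr 1
      ring
    · gcongr
  refine ⟨a, b, max (1 + |e|) ((2 * M) / ε ^ 4 + |a| / ε ^ 3 + |c| / ε ^ 2 + |b| / ε),
    fun v => ?_⟩
  rcases lt_or_ge |v| ε with hv | hv
  · exact (hloc v hv).trans (by gcongr; exact le_max_left _ _)
  · exact (hglob v hv).trans (by gcongr; exact le_max_right _ _)

lemma integral_eq_zero_of_odd {g : ℝ → ℝ} (hg : ∀ u, g (-u) = -g u) : ∫ u, g u = 0 := by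
  have h := integral_neg_eq_self g volume
  simp only [hg, integral_neg] at h
  linarith

/-- Fourth-order expansion of the mean of the kernel density estimator. -/
lemma exists_abs_bias_sub_le {f : ℝ → ℝ} (hfmeas : Measurable f) {x₀ : ℝ}
    (hf : ContDiffAt ℝ 4 f x₀) {M : ℝ} (hM : ∀ x, |f x| ≤ M)
    {K : ℝ → ℝ} (hK : IsDensityKernel K) (hK4 : Integrable fun u => u ^ 4 * K u) :
    ∃ C, ∀ h : ℝ, |(∫ u, K u * f (x₀ + h * u)) - f x₀
      - h ^ 2 * iteratedDeriv 2 f x₀ * kernelMoment2 K / 2| ≤ C * h ^ 4 := by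
  obtain ⟨a, b, C, hC⟩ := exists_abs_sub_cubic_taylor_le hf hM
  refine ⟨C * ∫ u, u ^ 4 * K u, fun h => ?_⟩
  set c := iteratedDeriv 2 f x₀ / 2 with hc
  have i0 := hK.integrable
  have i2 := hK.integrable_sq_mul
  -- The odd moments are finite by `|u| ≤ 1 + u²` and, below, `|u|³ ≤ u² + u⁴`; they then vanish by
  -- symmetry.
  have i1 : Integrable fun u => u * K u := by
    refine (i0.add i2).mono' (measurable_id.mul hK.measurable).aestronglyMeasurable
      (ae_of_all _ fun u => ?_)
    simp only [Pi.add_apply, Real.norm_eq_abs, abs_mul, abs_of_nonneg (hK.nonneg u)]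
    rw [← one_add_mul]
    refine mul_le_mul_of_nonneg_right ?_ (hK.nonneg u)
    rw [← sq_abs]
    nlinarith [sq_nonneg (|u| - 1), abs_nonneg u]
  have i3 : Integrable fun u => u ^ 3 * K u := by
    refine (i2.add hK4).mono' ((measurable_id.pow_const 3).mul hK.measurable).aestronglyMeasurable
      (ae_of_all _ fun u => ?_)
    simp only [Pi.add_apply, Real.norm_eq_abs, abs_mul, abs_of_nonneg (hK.nonneg u)]
    rw [← add_mul]
    refine mul_le_mul_of_nonneg_right ?_ (hK.nonneg u)
    have e2 : u ^ 2 = |u| ^ 2 := (sq_abs u).symm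
    have e4 : u ^ 4 = |u| ^ 4 := by rw [← abs_pow, abs_of_nonneg (by positivity)]
    rw [abs_pow, e2, e4]
    nlinarith [mul_nonneg (sq_nonneg |u|) (sq_nonneg (|u| - 1)), pow_nonneg (abs_nonneg u) 3]
  have iK : Integrable fun u => K u * f (x₀ + h * u) :=
    i0.mul_bdd (c := M) (hfmeas.comp (by fun_prop)).aestronglyMeasurable
      (ae_of_all _ fun u => hM _)
  have ip : Integrable fun u => f x₀ * K u + a * h * (u * K u) + c * h ^ 2 * (u ^ 2 * K u)
      + b * h ^ 3 * (u ^ 3 * K u) :=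
    (((i0.const_mul _).add (i1.const_mul _)).add (i2.const_mul _)).add (i3.const_mul _)
  have hp : ∫ u, (f x₀ * K u + a * h * (u * K u) + c * h ^ 2 * (u ^ 2 * K u)
      + b * h ^ 3 * (u ^ 3 * K u)) = f x₀ + c * h ^ 2 * kernelMoment2 K := by
    have j1 : Integrable fun u => f x₀ * K u + a * h * (u * K u) :=
      (i0.const_mul _).add (i1.const_mul _)
    have j2 : Integrable fun u => f x₀ * K u + a * h * (u * K u) + c * h ^ 2 * (u ^ 2 * K u) :=
      j1.add (i2.const_mul _)
    rw [integral_add j2 (i3.const_mul _), integral_add j1 (i2.const_mul _),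
      integral_add (i0.const_mul _) (i1.const_mul _), integral_const_mul, integral_const_mul,
      integral_const_mul, integral_const_mul, hK.integral_eq_one,
      integral_eq_zero_of_odd (g := fun u => u * K u) (fun u => by rw [hK.symmetric]; ring),
      integral_eq_zero_of_odd (g := fun u => u ^ 3 * K u) (fun u => by rw [hK.symmetric]; ring),
      kernelMoment2]
    ring
  have heq : (∫ u, K u * f (x₀ + h * u)) - f x₀
      - h ^ 2 * iteratedDeriv 2 f x₀ * kernelMoment2 K / 2
      = ∫ u, (K u * f (x₀ + h * u) - (f x₀ * K u + a * h * (u * K u) + c * h ^ 2 * (u ^ 2 * K u)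
        + b * h ^ 3 * (u ^ 3 * K u))) := by
    rw [integral_sub iK ip, hp, hc]
    ring
  rw [heq]
  rw [← Real.norm_eq_abs]
  calc _ ≤ ∫ u, C * h ^ 4 * (u ^ 4 * K u) := by
        refine norm_integral_le_of_norm_le (hK4.const_mul _) (ae_of_all _ fun u => ?_)
        have e : K u * f (x₀ + h * u) - (f x₀ * K u + a * h * (u * K u)
            + c * h ^ 2 * (u ^ 2 * K u) + b * h ^ 3 * (u ^ 3 * K u))
            = K u * (f (x₀ + h * u) - (f x₀ + a * (h * u) + c * (h * u) ^ 2 + b * (h * u) ^ 3)) := by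
          ring
        rw [e, Real.norm_eq_abs, abs_mul, abs_of_nonneg (hK.nonneg u)]
        refine (mul_le_mul_of_nonneg_left (hC (h * u)) (hK.nonneg u)).trans (le_of_eq ?_)
        ring
    _ = _ := by
        rw [integral_const_mul]
        ring

/-- A bounded function, convolved with a shrinking integrable kernel, converges at each of its
points of continuity. -/
lemma tendsto_integral_mul_comp_add_mul {ι : Type*} {l : Filter ι} [l.IsCountablyGenerated]
    {f : ℝ → ℝ} (hfmeas : Measurable f) {x₀ : ℝ} (hf : ContinuousAt f x₀) {M : ℝ}
    (hM : ∀ x, |f x| ≤ M) {G : ℝ → ℝ} (hG : Integrable G) {h : ι → ℝ} (hh : Tendsto h l (𝓝 0)) :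
    Tendsto (fun n => ∫ u, G u * f (x₀ + h n * u)) l (𝓝 ((∫ u, G u) * f x₀)) := by
  rw [← integral_mul_const]
  refine tendsto_integral_filter_of_dominated_convergence (fun u => |G u| * M) ?_ ?_
    (hG.abs.mul_const M) (ae_of_all _ fun u => ?_)
  · exact Eventually.of_forall fun n =>
      hG.aestronglyMeasurable.mul (hfmeas.comp (by fun_prop)).aestronglyMeasurable
  · refine Eventually.of_forall fun n => ae_of_all _ fun u => ?_
    rw [Real.norm_eq_abs, abs_mul]
    exact mul_le_mul_of_nonneg_left (hM _) (abs_nonneg _)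
  · refine tendsto_const_nhds.mul (hf.tendsto.comp ?_)
    simpa using (hh.mul_const u).const_add x₀

lemma IsDensityKernel.integral_sq_pos {K : ℝ → ℝ} (hK : IsDensityKernel K) :
    0 < ∫ u, K u ^ 2 := by
  refine lt_of_le_of_ne (integral_nonneg fun u => sq_nonneg _) fun h0 => ?_
  have h1 := (integral_eq_zero_iff_of_nonneg (fun u => sq_nonneg (K u)) hK.integrable_sq).1 h0.symm
  have h2 : ∫ u, K u = 0 := integral_eq_zero_of_ae (h1.mono fun u hu => by simpa using hu)
  rw [hK.integral_eq_one] at h2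
  exact one_ne_zero h2

/-! ### Variance and normal approximation of the estimator -/

section Estimator

variable {Ω : Type*} [MeasurableSpace Ω] {P : Measure Ω}
  {X : ℕ → Ω → ℝ} {K : ℝ → ℝ}

lemma identDistrib_comp_standardize (hident : ∀ i, IdentDistrib (X i) (X 0) P P)
    (hK : Measurable K) (x₀ h : ℝ) (i : ℕ) :
    IdentDistrib (fun ω => K ((X i ω - x₀) / h)) (fun ω => K ((X 0 ω - x₀) / h)) P P :=
  (hident i).comp (u := fun x => K ((x - x₀) / h)) (hK.comp (by fun_prop))

lemma iIndepFun_comp_standardize (hindep : iIndepFun X P) (hK : Measurable K) (x₀ h : ℝ) :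
    iIndepFun (fun i ω => K ((X i ω - x₀) / h)) P :=
  hindep.comp (fun _ x => K ((x - x₀) / h)) fun _ => hK.comp (by fun_prop)

variable [IsProbabilityMeasure P]

lemma IsDensityKernel.memLp_comp_standardize (hK : IsDensityKernel K) {Y : Ω → ℝ}
    (hY : Measurable Y) (x₀ h : ℝ) : MemLp (fun ω => K ((Y ω - x₀) / h)) 2 P := by
  obtain ⟨M, hM⟩ := hK.bounded
  refine MemLp.of_bound (hK.measurable.comp (by fun_prop)).aestronglyMeasurable M
    (ae_of_all _ fun ω => ?_)
  rw [Real.norm_eq_abs, abs_of_nonneg (hK.nonneg _)]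
  exact hM _

lemma variance_kernelDensityEstimator (hmeas : ∀ i, Measurable (X i)) (hindep : iIndepFun X P)
    (hident : ∀ i, IdentDistrib (X i) (X 0) P P) (hK : IsDensityKernel K) (n : ℕ) (h x₀ : ℝ) :
    variance (kernelDensityEstimator K X n h x₀) P
      = ((n : ℝ) * h)⁻¹ ^ 2 * (n * variance (fun ω => K ((X 0 ω - x₀) / h)) P) := by
  have h1 := IndepFun.variance_sum (s := Finset.range n)
    (fun i _ => hK.memLp_comp_standardize (P := P) (hmeas i) x₀ h)
    (fun i _ j _ hij => (iIndepFun_comp_standardize hindep hK.measurable x₀ h).indepFun hij)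
  simp only [(identDistrib_comp_standardize hident hK.measurable x₀ h _).variance_eq,
    Finset.sum_const, Finset.card_range, nsmul_eq_mul] at h1
  rw [← h1, ← variance_const_mul]
  congr 1
  ext ω
  simp [kernelDensityEstimator]

lemma sq_kdeSigma (hmeas : ∀ i, Measurable (X i)) (hindep : iIndepFun X P)
    (hident : ∀ i, IdentDistrib (X i) (X 0) P P) (hK : IsDensityKernel K) {n : ℕ} (hn : 0 < n)
    {h : ℝ} (hh : 0 < h) (x₀ : ℝ) :
    kdeSigma P K X n h x₀ ^ 2 = variance (fun ω => K ((X 0 ω - x₀) / h)) P / h := by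
  have hn' : (0 : ℝ) < n := by exact_mod_cast hn
  rw [kdeSigma, Real.sq_sqrt (mul_nonneg (by positivity) (variance_nonneg _ _)),
    variance_kernelDensityEstimator hmeas hindep hident hK]
  field_simp

/-- Berry-Esseen bound for the kernel density estimator, centred at its mean. -/
lemma abs_measureReal_kde_sub_stdNormalCDF_le (hmeas : ∀ i, Measurable (X i))
    (hindep : iIndepFun X P) (hident : ∀ i, IdentDistrib (X i) (X 0) P P)
    (hK : IsDensityKernel K) {M : ℝ} (hM0 : 0 < M) (hM : ∀ u, K u ≤ M) {n : ℕ} (hn : 0 < n) {h : ℝ}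
    (hh : 0 < h) {x₀ : ℝ} (hσ : 0 < kdeSigma P K X n h x₀)
    (hδ : M / (√(n * h) * kdeSigma P K X n h x₀) ≤ 1) (a y : ℝ) :
    |P.real {ω | √(n * h) * (kernelDensityEstimator K X n h x₀ ω - a) ≤ y}
      - stdNormalCDF ((y - √(n * h) * ((∫ ω, K ((X 0 ω - x₀) / h) ∂P) / h - a))
          / kdeSigma P K X n h x₀)|
      ≤ 22 * (M / (√(n * h) * kdeSigma P K X n h x₀)) := by
  have hn' : (0 : ℝ) < n := by exact_mod_cast hn
  have hσ2 := sq_kdeSigma hmeas hindep hident hK hn hh x₀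
  set σ := kdeSigma P K X n h x₀
  have hr : 0 < √(n * h) := Real.sqrt_pos.2 (by positivity)
  have hr2 : √(n * h) ^ 2 = n * h := Real.sq_sqrt (by positivity)
  set r := √(n * h)
  set Y : ℕ → Ω → ℝ := fun i ω => K ((X i ω - x₀) / h) with hY
  have hYm : ∀ i, Measurable (Y i) := fun i => hK.measurable.comp (by have := hmeas i; fun_prop)
  have hYL : ∀ i, MemLp (Y i) 2 P := fun i => hK.memLp_comp_standardize (hmeas i) x₀ h
  have hYid : ∀ i, IdentDistrib (Y i) (Y 0) P P := fun i =>
    identDistrib_comp_standardize hident hK.measurable x₀ h i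
  change σ ^ 2 = variance (Y 0) P / h at hσ2
  change |_ - stdNormalCDF ((y - r * ((∫ ω, Y 0 ω ∂P) / h - a)) / σ)| ≤ _
  set m := ∫ ω, Y 0 ω ∂P with hm
  have hYint : ∀ i, Integrable (Y i) P := fun i => (hYL i).integrable one_le_two
  have hYmean : ∀ i, ∫ ω, Y i ω ∂P = m := fun i => (hYid i).integral_eq
  have hm0 : 0 ≤ m := integral_nonneg fun ω => hK.nonneg _
  have hmM : m ≤ M := by
    have := integral_mono (hYint 0) (integrable_const M) fun ω => hM _
    simpa using this
  have hbe := abs_measureReal_sum_le_sub_stdNormalCDF_le (P := P)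
    (ξ := fun i ω => (Y i ω - m) / (r * σ)) (δ := M / (r * σ)) (s := Finset.range n)
    (fun i => ((hYm i).sub_const m).div_const _)
    ((iIndepFun_comp_standardize hindep hK.measurable x₀ h).comp (fun _ v => (v - m) / (r * σ))
      fun _ => by fun_prop)
    (by positivity) hδ
    (fun i ω => by
      rw [abs_div, abs_of_pos (mul_pos hr hσ)]
      have h1 : 0 ≤ Y i ω := hK.nonneg _
      have h2 : Y i ω ≤ M := hM _
      gcongr
      rw [abs_le]
      constructor <;> linarith)
    (fun i => by
      rw [integral_div, integral_sub (hYint i) (integrable_const m), hYmean]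
      simp)
    (by
      have h1 : ∀ i, ∫ ω, ((Y i ω - m) / (r * σ)) ^ 2 ∂P = variance (Y 0) P / (r * σ) ^ 2 := by
        intro i
        simp only [div_pow]
        rw [integral_div, ← (hYid i).variance_eq,
          variance_eq_integral (hYm i).aemeasurable, hYmean]
      simp only [h1, Finset.sum_const, Finset.card_range, nsmul_eq_mul]
      have hv : variance (Y 0) P = σ ^ 2 * h := by
        rw [hσ2]
        field_simp
      rw [hv, mul_pow, hr2]
      field_simp)
    ((y - r * (m / h - a)) / σ)
  convert hbe using 5
  ext ω
  have hsum : ∑ i ∈ Finset.range n, (Y i ω - m) / (r * σ)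
      = r * (kernelDensityEstimator K X n h x₀ ω - m / h) / σ := by
    rw [← Finset.sum_div, Finset.sum_sub_distrib, Finset.sum_const, Finset.card_range,
      nsmul_eq_mul, kernelDensityEstimator]
    change _ = r * (((n : ℝ) * h)⁻¹ * ∑ i ∈ Finset.range n, Y i ω - m / h) / σ
    have hnr : (n : ℝ) = r ^ 2 / h := by rw [hr2]; field_simp
    rw [hnr]
    field_simp
  change _ ≤ y ↔ _ ≤ _
  rw [hsum, div_le_div_iff_of_pos_right hσ]
  constructor <;> intro h <;> linarith

end Estimator

/-- `σ_h` is bounded away from zero as the bandwidth tends to zero. -/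
lemma exists_pos_eventually_le_kdeSigma {Ω : Type*} [MeasurableSpace Ω] {P : Measure Ω}
    [IsProbabilityMeasure P] {X : ℕ → Ω → ℝ} (hmeas : ∀ i, Measurable (X i))
    (hindep : iIndepFun X P) (hident : ∀ i, IdentDistrib (X i) (X 0) P P)
    {f : ℝ → ℝ} (hfmeas : Measurable f) (hfnonneg : ∀ x, 0 ≤ f x)
    (hfdens : P.map (X 0) = volume.withDensity fun x => ENNReal.ofReal (f x))
    {M : ℝ} (hM : ∀ x, |f x| ≤ M) {x₀ : ℝ} (hfpos : 0 < f x₀) (hf : ContinuousAt f x₀)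
    {K : ℝ → ℝ} (hK : IsDensityKernel K) {h : ℕ → ℝ} (hpos : ∀ n, 0 < h n)
    (hh : Tendsto h atTop (𝓝 0)) :
    ∃ c > 0, ∀ᶠ n in atTop, c ≤ kdeSigma P K X n (h n) x₀ := by
  -- By change of variables `σ_h² = ∫ K(u)² f(x₀ + hu) du - h (∫ K(u) f(x₀ + hu) du)²`. The limit is
  -- `f x₀ ∫ K² > 0`, and half of it is an eventual lower bound.
  have t1 := tendsto_integral_mul_comp_add_mul hfmeas hf hM hK.integrable_sq hh
  have t2 := tendsto_integral_mul_comp_add_mul hfmeas hf hM hK.integrable hh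
  have t3 := t1.sub (hh.mul (t2.pow 2))
  rw [zero_mul, sub_zero] at t3
  have hL : 0 < (∫ u, K u ^ 2) * f x₀ := mul_pos hK.integral_sq_pos hfpos
  refine ⟨√((∫ u, K u ^ 2) * f x₀ / 2), Real.sqrt_pos.2 (by positivity), ?_⟩
  filter_upwards [t3.eventually_const_le (half_lt_self hL), eventually_gt_atTop 0] with n hn hn0
  refine Real.sqrt_le_iff.2 ⟨Real.sqrt_nonneg _, ?_⟩
  have e1 := integral_comp_standardize (hmeas 0) hfmeas hfnonneg hfdens hK.measurable x₀ (hpos n)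
  have e2 := integral_comp_standardize (hmeas 0) hfmeas hfnonneg hfdens
    (hK.measurable.pow_const 2) x₀ (hpos n)
  have hp := hpos n
  rw [sq_kdeSigma hmeas hindep hident hK hn0 hp,
    variance_eq_sub (hK.memLp_comp_standardize (hmeas 0) x₀ (h n)), e1]
  simp only [Pi.pow_apply]
  rw [e2]
  refine hn.trans (le_of_eq ?_)
  field_simp

/-! ### Combining the normal approximation with the bias expansion -/

theorem theorem11 {Ω : Type*} [MeasurableSpace Ω] (P : Measure Ω) [IsProbabilityMeasure P]
    -- the i.i.d. observations
    (X : ℕ → Ω → ℝ) (hXmeas : ∀ i, Measurable (X i)) (hXindep : iIndepFun X P)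
    (hXident : ∀ i, IdentDistrib (X i) (X 0) P P)
    -- their common density, bounded, and at `x₀` positive and four times continuously differentiable
    (f : ℝ → ℝ) (hfmeas : Measurable f) (hfnonneg : ∀ x, 0 ≤ f x)
    (hfdens : P.map (X 0) = volume.withDensity fun x => ENNReal.ofReal (f x))
    (hfbdd : ∃ M : ℝ, ∀ x, f x ≤ M)
    (x₀ : ℝ) (hfpos : 0 < f x₀) (hfsmooth : ContDiffAt ℝ 4 f x₀)
    -- the kernel
    (K : ℝ → ℝ) (hK : IsDensityKernel K) (hK4 : Integrable fun u => u ^ 4 * K u)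
    -- the bandwidths
    (h : ℕ → ℝ) (hpos : ∀ n, 0 < h n)
    (hnh : Tendsto (fun n : ℕ => (n : ℝ) * h n) atTop atTop)
    (hrate : h =O[atTop] fun n : ℕ => (n : ℝ) ^ (-(1 / 5) : ℝ))
    (y : ℝ) :
    (fun n : ℕ =>
        P.real {ω | ((n : ℝ) * h n) ^ (1 / 2 : ℝ) *
            (kernelDensityEstimator K X n (h n) x₀ ω - f x₀) ≤ y}
          - stdNormalCDF
              ((y - (n : ℝ) ^ (1 / 2 : ℝ) * h n ^ (5 / 2 : ℝ) * iteratedDeriv 2 f x₀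
                    * kernelMoment2 K / 2)
                / kdeSigma P K X n (h n) x₀))
      =O[atTop] fun n : ℕ =>
        (n : ℝ) ^ (1 / 2 : ℝ) * h n ^ (9 / 2 : ℝ) + ((n : ℝ) * h n) ^ (-(1 / 2) : ℝ) := by
  obtain ⟨Mf, hMf⟩ := hfbdd
  obtain ⟨M, hM⟩ := hK.bounded
  have hMf' : ∀ x, |f x| ≤ Mf := fun x => by
    rw [abs_of_nonneg (hfnonneg x)]
    exact hMf x
  -- The maximum with 1 makes the bound visibly positive, so that `δ > 0` in the Berry-Esseen step.
  have hM' : ∀ u, K u ≤ max M 1 := fun u => (hM u).trans (le_max_left _ _)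
  have hM0 : 0 < max M 1 := lt_max_of_lt_right one_pos
  have hh : Tendsto h atTop (𝓝 0) := hrate.trans_tendsto
    ((tendsto_rpow_neg_atTop (by norm_num : (0 : ℝ) < 1 / 5)).comp tendsto_natCast_atTop_atTop)
  obtain ⟨c, hc, hσ⟩ := exists_pos_eventually_le_kdeSigma hXmeas hXindep hXident hfmeas hfnonneg
    hfdens hMf' hfpos hfsmooth.continuousAt hK hpos hh
  obtain ⟨C, hC⟩ := exists_abs_bias_sub_le hfmeas hfsmooth hMf' hK hK4
  have hC0 : 0 ≤ C := by simpa using (abs_nonneg _).trans (hC 1)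
  have hsqrt : Tendsto (fun n : ℕ => √(n * h n)) atTop atTop := Real.tendsto_sqrt_atTop.comp hnh
  -- The first summand is the Berry-Esseen constant, the second the bias constant; both are divided
  -- by the lower bound `c` of `σ_h`.
  refine IsBigO.of_bound (22 * max M 1 / c + C / c) ?_
  filter_upwards [hσ, eventually_gt_atTop 0, hsqrt.eventually_ge_atTop (max M 1 / c)]
    with n hcσ hn hlarge
  have hp := hpos n
  have hn' : (0 : ℝ) < n := by exact_mod_cast hn
  have hr : 0 < √(n * h n) := Real.sqrt_pos.2 (by positivity)
  have hσ0 : 0 < kdeSigma P K X n (h n) x₀ := hc.trans_le hcσ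
  have hδ : max M 1 / (√(n * h n) * kdeSigma P K X n (h n) x₀) ≤ max M 1 / c / √(n * h n) := by
    rw [div_div, mul_comm c]
    gcongr
  have hδ1 : max M 1 / c / √(n * h n) ≤ 1 := (div_le_one hr).2 hlarge
  have hbe := abs_measureReal_kde_sub_stdNormalCDF_le hXmeas hXindep hXident hK hM0 hM' hn hp hσ0
    (hδ.trans hδ1) (f x₀) y
  rw [integral_comp_standardize (hXmeas 0) hfmeas hfnonneg hfdens hK.measurable x₀ hp,
    mul_div_cancel_left₀ _ hp.ne'] at hbe
  have hbias := hC (h n)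
  have e1 : ((n : ℝ) * h n) ^ (1 / 2 : ℝ) = √(n * h n) := (Real.sqrt_eq_rpow _).symm
  have e2 : ((n : ℝ) * h n) ^ (-(1 / 2) : ℝ) = 1 / √(n * h n) := by
    rw [Real.rpow_neg (by positivity), e1, one_div]
  have e3 : (n : ℝ) ^ (1 / 2 : ℝ) * h n ^ (5 / 2 : ℝ) = √(n * h n) * h n ^ 2 := by
    rw [← e1, Real.mul_rpow hn'.le hp.le, mul_assoc, ← Real.rpow_natCast, ← Real.rpow_add hp]
    norm_num
  have e4 : (n : ℝ) ^ (1 / 2 : ℝ) * h n ^ (9 / 2 : ℝ) = √(n * h n) * h n ^ 4 := by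
    rw [← e1, Real.mul_rpow hn'.le hp.le, mul_assoc, ← Real.rpow_natCast, ← Real.rpow_add hp]
    norm_num
  rw [e1, e2, e3, e4]
  set r := √(n * h n)
  set σ := kdeSigma P K X n (h n) x₀
  set b := (∫ u, K u * f (x₀ + h n * u)) - f x₀
  -- Replacing the exact bias `b` by its leading term shifts the argument of `Φ` by at most `r C h⁴
  -- / σ`.
  have hlip : |stdNormalCDF ((y - r * b) / σ) - stdNormalCDF
      ((y - r * h n ^ 2 * iteratedDeriv 2 f x₀ * kernelMoment2 K / 2) / σ)|
      ≤ C / c * (r * h n ^ 4) := by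
    refine (abs_stdNormalCDF_sub_le _ _).trans ?_
    have e : (y - r * b) / σ - (y - r * h n ^ 2 * iteratedDeriv 2 f x₀ * kernelMoment2 K / 2) / σ
        = -(r * (b - h n ^ 2 * iteratedDeriv 2 f x₀ * kernelMoment2 K / 2) / σ) := by
      ring
    rw [e, abs_neg, abs_div, abs_mul, abs_of_pos hr, abs_of_pos hσ0]
    calc _ ≤ r * (C * h n ^ 4) / c := by gcongr
      _ = _ := by ring
  have hrhs : 0 ≤ r * h n ^ 4 + 1 / r := by positivity
  rw [Real.norm_eq_abs, Real.norm_of_nonneg hrhs]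
  refine (abs_sub_le _ (stdNormalCDF ((y - r * b) / σ)) _).trans ?_
  have hbe' := hbe.trans (mul_le_mul_of_nonneg_left hδ (by norm_num))
  refine le_trans (add_le_add hbe' hlip) ?_
  have h1 : 0 ≤ 22 * max M 1 / c * (r * h n ^ 4) := by positivity
  have h2 : 0 ≤ C / c * (1 / r) := by positivity
  have h3 : 22 * (max M 1 / c / r) = 22 * max M 1 / c * (1 / r) := by ring
  rw [h3]
  linarith
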